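/- A (symmetric) association scheme of $D$ classes is a finite set $X$ with non-empty relations $R_0,\dots,R_D\subseteq X\times X$ whose adjacency matrices $A_0,\dots,A_D$ satisfy $A_0=I$, $\sum_i A_i=J$ (the all-one matrix), $A_i^\top=A_i$, and $A_iA_j=\sum_k p_{ij}^kA_k$ with nonnegative integers $p_{ij}^k$. Let $E_0=\frac1{|X|}J,E_1,\dots,E_D$ be the primitive idempotents of the real algebra spanned by the $A_i$. The second eigenmatrix $Q$ and the Krein parameters $q_{ij}^k$ are defined by $E_i=\frac1{|X|}\sum_j Q_{ji}A_j$ and $E_i\circ E_j=\frac1{|X|}\sum_k q_{ij}^kE_k$, where $\circ$ is the entrywise product. The scheme is $Q$-polynomial if, for some ordering of $E_1,\dots,E_D$, there is for each $0\le i\le D$ a real polynomial $v_i^*$ of degree $i$ with $Q_{ji}=v_i^*(Q_{j1})$ for all $0\le j\le D$. Its Krein array (with respect to such an ordering) is $\{b_0^*,\dots,b_{D-1}^*;\,c_1^*,\dots,c_D^*\}$ with $b_i^*=q_{1,i+1}^i$ and $c_i^*=q_{1,i-1}^i$. Theorem. Let $r>0$ be a real number and let $(X,\{R_i\}_{i=0}^4)$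 be a $Q$-polynomial association scheme of $4$ classes with Krein array $\{r^2-4,\,r^2-9,\,10,\,1;\;1,\,2,\,r^2-9,\,r^2-4\}$. Then $r=9$. -/

import Mathlib

open scoped Matrix

namespace QPolyScheme

section Definitions

variable {X : Type*} [Fintype X] [DecidableEq X] {D : ℕ}

open Classical in
/-- The adjacency matrix of the graph `(X, S)`. -/
noncomputable def adj (S : Set (X × X)) : Matrix X X ℝ :=
  Matrix.of fun x y => if (x, y) ∈ S then 1 else 0

/-- `(X, {R_0, …, R_D})` is a symmetric association scheme of `D` classes. The numbers `p i j k`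
are the intersection numbers `p_{ij}^k`. -/
structure IsAssociationScheme (R : Fin (D + 1) → Set (X × X)) : Prop where
  nonempty : ∀ i, (R i).Nonempty
  adj_zero : adj (R 0) = 1
  sum_adj : ∑ i, adj (R i) = Matrix.of fun _ _ => 1
  symm : ∀ i, (adj (R i))ᵀ = adj (R i)
  mul_adj : ∃ p : Fin (D + 1) → Fin (D + 1) → Fin (D + 1) → ℕ,
    ∀ i j, adj (R i) * adj (R j) = ∑ k, (p i j k : ℝ) • adj (R k)

/-- `E_0, …, E_D` is an ordering, with `E_0 = J / |X|`, of the primitive idempotents of the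
algebra spanned by the adjacency matrices. This algebra has dimension `D + 1`, so `D + 1` nonzero
orthogonal idempotents in it with sum `I` are precisely its primitive idempotents. -/
structure IsPrimitiveIdempotents (R : Fin (D + 1) → Set (X × X))
    (E : Fin (D + 1) → Matrix X X ℝ) : Prop where
  zero : E 0 = (1 / (Fintype.card X : ℝ)) • Matrix.of fun _ _ => 1
  mem_span : ∀ i, E i ∈ Submodule.span ℝ (Set.range fun j => adj (R j))
  ne_zero : ∀ i, E i ≠ 0
  complete_orthogonal : CompleteOrthogonalIdempotents E

/-- `Q` is the second eigenmatrix: `E_i = |X|⁻¹ ∑_j Q_{ji} A_j`. -/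
def IsSecondEigenmatrix (R : Fin (D + 1) → Set (X × X)) (E : Fin (D + 1) → Matrix X X ℝ)
    (Q : Matrix (Fin (D + 1)) (Fin (D + 1)) ℝ) : Prop :=
  ∀ i, E i = (1 / (Fintype.card X : ℝ)) • ∑ j, Q j i • adj (R j)

/-- The numbers `q i j k` are the Krein parameters `q_{ij}^k`, defined by
`E_i ∘ E_j = |X|⁻¹ ∑_k q_{ij}^k E_k` with the entrywise product `∘`. -/
def IsKreinParameters (E : Fin (D + 1) → Matrix X X ℝ)
    (q : Fin (D + 1) → Fin (D + 1) → Fin (D + 1) → ℝ) : Prop :=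
  ∀ i j, E i ⊙ E j = (1 / (Fintype.card X : ℝ)) • ∑ k, q i j k • E k

/-- `E_0, …, E_D` is a `Q`-polynomial ordering of the primitive idempotents: for each `i` there
is a polynomial `v` of degree `i` such that `Q_{ji} = v(Q_{j1})` for all `j`. -/
def IsQPolynomialOrdering (R : Fin (D + 1) → Set (X × X))
    (E : Fin (D + 1) → Matrix X X ℝ) : Prop :=
  IsPrimitiveIdempotents R E ∧
    ∃ Q : Matrix (Fin (D + 1)) (Fin (D + 1)) ℝ, IsSecondEigenmatrix R E Q ∧
      ∀ i : Fin (D + 1), ∃ v : Polynomial ℝ, v.degree = ((i : ℕ) : WithBot ℕ) ∧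
        ∀ j, Q j i = v.eval (Q j 1)

/-- `(X, {R_i})` is `Q`-polynomial with Krein array `{b_0, …, b_{D-1}; c_1, …, c_D}`, where
`b_i = q_{1,i+1}^i` and `c_{i+1} = q_{1,i}^{i+1}` for `0 ≤ i < D`, the Krein parameters being
taken in a `Q`-polynomial ordering of the primitive idempotents. The second list is indexed from
`0`, so `c i` stands for the parameter `c_{i+1}`. -/
def IsQPolynomialWithKreinArray (R : Fin (D + 1) → Set (X × X)) (b c : Fin D → ℝ) : Prop :=
  ∃ E : Fin (D + 1) → Matrix X X ℝ, IsQPolynomialOrdering R E ∧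
    ∃ q : Fin (D + 1) → Fin (D + 1) → Fin (D + 1) → ℝ, IsKreinParameters E q ∧
      (∀ i : Fin D, q 1 i.succ i.castSucc = b i) ∧
      (∀ i : Fin D, q 1 i.castSucc i.succ = c i)

end Definitions

end QPolyScheme

/-! Put n = |X|, θ = n E₁ and φ = n E₄. The Krein array makes the scheme Q-antipodal: the three-term
recurrence for the columns of Q forces φ to take only the values 5 and -1, so X splits into fibres
of size n/6. It also forces θ = -4 ± r inside a fibre (off the diagonal) and θ = 2 ± r between
fibres. Hence θ is encoded by a sign function `sgn`, and n = r²(r² - 1)/2.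

The vanishing Krein parameters q₁₁⁴ and q₁₁³ give ∑ θ_u θ_v φ_w = 0 and, because E₁ ∘ E₄ is a
multiple of E₃, also ∑ θ_u θ_v θ_w φ_w = 0. So sums of θ_u θ_v over any fibre, and of θ_u θ_v θ_w
over the fibre of u, v or w, are one sixth of the total.

Sums of one and of two signs over a fibre show that r is an integer (`LinkedSystem.mem_intSubring`)
and that three points u, v, w in distinct fibres with all mutual θ equal to 2 + r exist
(`exists_triangle`). For these, the total T of θ_u θ_v θ_w is not known, but it cancels between the
sign sum over one of the three fibres and the one over their complement. What is left is 2rM = 3(r²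
- 1)(r + 6) with M an integer (`integer_identity`), so r divides 18. With r > 3, only 6, 9 and 18
remain. The number (r² - 1)(r² - 3r + 6)/48 counts common neighbours in a fibre (`sum_fib_pos_mul`),
and its integrality leaves only 9. -/

/-! ### Integrality in the reals -/

/-- The subring of integers in `ℝ`. -/
abbrev intSubring : Subring ℝ := (Int.castRingHom ℝ).range

theorem mem_intSubring {x : ℝ} : x ∈ intSubring ↔ ∃ m : ℤ, (m : ℝ) = x := by
  simp [intSubring, RingHom.mem_range]

/-- A rational real number with integral square is an integer. -/
theorem mem_intSubring_of_sq {r a b : ℝ} (ha : a ∈ intSubring) (hb : b ∈ intSubring)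
    (ha0 : a ≠ 0) (hab : a * r = b) (hr : r ^ 2 ∈ intSubring) : r ∈ intSubring := by
  rw [mem_intSubring] at *
  obtain ⟨a, rfl⟩ := ha
  obtain ⟨b, rfl⟩ := hb
  obtain ⟨m, hm⟩ := hr
  have hq : r = (((b : ℚ) / (a : ℚ) : ℚ) : ℝ) := by
    push_cast
    rw [eq_div_iff ha0, mul_comm, hab]
  generalize (b : ℚ) / (a : ℚ) = q at hq
  subst hq
  have h1 : q ^ 2 = (m : ℚ) := by exact_mod_cast hm.symm
  have h2 : (q ^ 2).den = 1 := by rw [h1]; simp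
  rw [Rat.den_pow] at h2
  have h3 : q.den = 1 := by simpa using h2
  refine ⟨q.num, ?_⟩
  have h4 := Rat.coe_int_num_of_den_eq_one h3
  exact_mod_cast h4

/-! ### Fibres and sums over them -/

/-- The combinatorial data carried by the matrices `θ = |X| E₁` and `φ = |X| E₄` of a scheme with
the given Krein array. -/
structure LinkedSystem (X : Type*) [Fintype X] (r : ℝ) (θ φ : X → X → ℝ) : Prop where
  lt : 3 < r
  card : (Fintype.card X : ℝ) = r ^ 2 * (r ^ 2 - 1) / 2
  symm_θ : ∀ x y, θ x y = θ y x
  symm_φ : ∀ x y, φ x y = φ y x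
  diag_θ : ∀ x, θ x x = r ^ 2 - 4
  diag_φ : ∀ x, φ x x = 5
  off_diag : ∀ x y, x ≠ y → (φ x y = 5 ∧ (θ x y = -4 + r ∨ θ x y = -4 - r)) ∨
    (φ x y = -1 ∧ (θ x y = 2 + r ∨ θ x y = 2 - r))
  sum_θ : ∀ u, ∑ x, θ u x = 0
  sum_φ : ∀ u, ∑ x, φ u x = 0
  sum_φφ : ∀ u v, ∑ x, φ u x * φ v x = Fintype.card X * φ u v
  sum_θθ : ∀ u v, ∑ x, θ u x * θ v x = Fintype.card X * θ u v
  sum_θφ : ∀ u w, ∑ x, θ u x * φ w x = 0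
  sum_θθφ : ∀ u v w, ∑ x, θ u x * θ v x * φ w x = 0
  sum_θθθφ : ∀ u v w, ∑ x, θ u x * θ v x * (θ w x * φ w x) = 0

namespace LinkedSystem

variable {X : Type*} [Fintype X] {r : ℝ} {θ φ : X → X → ℝ}

theorem φ_eq (h : LinkedSystem X r θ φ) (x y : X) : φ x y = 5 ∨ φ x y = -1 := by
  by_cases hxy : x = y
  · subst hxy; exact Or.inl (h.diag_φ x)
  · rcases h.off_diag x y hxy with h' | h'
    · exact Or.inl h'.1
    · exact Or.inr h'.1

open Classical in
/-- The fibre of `w`. -/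
noncomputable def fib (φ : X → X → ℝ) (w : X) : Finset X := Finset.univ.filter fun x => φ w x = 5

theorem mem_fib {w x : X} : x ∈ fib φ w ↔ φ w x = 5 := by simp [fib]

theorem φ_eq_of_notMem (h : LinkedSystem X r θ φ) {w x : X} (hx : x ∉ fib φ w) : φ w x = -1 :=
  (h.φ_eq w x).resolve_left fun h' => hx (mem_fib.2 h')

theorem mem_fib_comm (h : LinkedSystem X r θ φ) {x y : X} : x ∈ fib φ y ↔ y ∈ fib φ x := by
  rw [mem_fib, mem_fib, h.symm_φ]

/-- φ_w + 1 is six times the indicator function of the fibre of w. -/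
theorem sum_fib (h : LinkedSystem X r θ φ) (w : X) (g : X → ℝ) :
    ∑ x ∈ fib φ w, g x = (∑ x, g x * φ w x + ∑ x, g x) / 6 := by
  classical
  rw [fib, Finset.sum_filter, ← Finset.sum_add_distrib, Finset.sum_div]
  refine Finset.sum_congr rfl fun x _ => ?_
  rcases h.φ_eq w x with h' | h'
  · rw [if_pos h', h']; ring
  · rw [if_neg (by rw [h']; norm_num), h']; ring

theorem card_fib (h : LinkedSystem X r θ φ) (w : X) :
    ∑ _x ∈ fib φ w, (1 : ℝ) = Fintype.card X / 6 := by
  rw [h.sum_fib]; simp [h.sum_φ]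

theorem sum_fib_θ (h : LinkedSystem X r θ φ) (w u : X) : ∑ x ∈ fib φ w, θ u x = 0 := by
  rw [h.sum_fib]; simp [h.sum_θ, h.sum_θφ]

theorem sum_fib_θθ (h : LinkedSystem X r θ φ) (w u v : X) :
    ∑ x ∈ fib φ w, θ u x * θ v x = Fintype.card X / 6 * θ u v := by
  rw [h.sum_fib, h.sum_θθφ, h.sum_θθ]; ring

/-- The only fibre sum of a triple product that is determined by the total: it needs w to be one of
the three points, since `sum_θθθφ` has the same w in θ and φ. -/
theorem sum_fib_θθθ (h : LinkedSystem X r θ φ) (w u v : X) :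
    ∑ x ∈ fib φ w, θ u x * θ v x * θ w x = (∑ x, θ u x * θ v x * θ w x) / 6 := by
  rw [h.sum_fib]
  simp only [mul_assoc]
  have := h.sum_θθθφ u v w
  simp only [mul_assoc] at this
  rw [this, zero_add]

/-- (φ_u + 1)(φ_v + 1) is 36 on the intersection of the fibres and 0 elsewhere, and its sum over X
is n(φ(u, v) + 1) = 0. -/
theorem disjoint_fib (h : LinkedSystem X r θ φ) {u v : X} (huv : v ∉ fib φ u) :
    Disjoint (fib φ u) (fib φ v) := by
  classical
  have h1 := h.sum_φφ u v
  rw [h.φ_eq_of_notMem huv] at h1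
  have h2 : ∀ x, φ u x * φ v x + φ u x + φ v x + 1 =
      36 * (if x ∈ fib φ u ∧ x ∈ fib φ v then 1 else 0) := by
    intro x
    simp only [mem_fib]
    rcases h.φ_eq u x with h' | h' <;> rcases h.φ_eq v x with h'' | h'' <;>
      norm_num [h', h'']
  have h3 : ∑ x, (φ u x * φ v x + φ u x + φ v x + 1) = 0 := by
    simp only [Finset.sum_add_distrib, h1, h.sum_φ]
    simp
  rw [Finset.sum_congr rfl fun x _ => h2 x, ← Finset.mul_sum, Finset.sum_boole] at h3
  rw [Finset.disjoint_left]
  intro x hx hx'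
  have h4 : (Finset.univ.filter fun x => x ∈ fib φ u ∧ x ∈ fib φ v).card = 0 := by
    have : (36 : ℝ) ≠ 0 := by norm_num
    exact_mod_cast (mul_eq_zero.1 h3).resolve_left this
  rw [Finset.card_eq_zero] at h4
  have : x ∈ Finset.univ.filter fun x => x ∈ fib φ u ∧ x ∈ fib φ v := by simp [hx, hx']
  rw [h4] at this
  simp at this

/-! ### Signs and their sums over a fibre -/

/-- The sign that distinguishes the two relations inside, and the two outside, the fibres. -/
noncomputable def sgn (r : ℝ) (θ φ : X → X → ℝ) (x y : X) : ℝ := (θ x y - 1 + φ x y) / r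

theorem θ_eq (h : LinkedSystem X r θ φ) (x y : X) : θ x y = 1 - φ x y + r * sgn r θ φ x y := by
  have := h.lt
  rw [sgn, mul_div_cancel₀ _ (by linarith)]; ring

theorem sgn_off_diag (h : LinkedSystem X r θ φ) {x y : X} (hxy : x ≠ y) :
    sgn r θ φ x y = 1 ∨ sgn r θ φ x y = -1 := by
  have hr : r ≠ 0 := by have := h.lt; linarith
  rcases h.off_diag x y hxy with ⟨h1, h2 | h2⟩ | ⟨h1, h2 | h2⟩
  · left; rw [sgn, h1, h2]; field_simp; ring
  · right; rw [sgn, h1, h2]; field_simp; ring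
  · left; rw [sgn, h1, h2]; field_simp; ring
  · right; rw [sgn, h1, h2]; field_simp; ring

theorem sgn_diag (h : LinkedSystem X r θ φ) (x : X) : sgn r θ φ x x = r := by
  have hr : r ≠ 0 := by have := h.lt; linarith
  rw [sgn, h.diag_φ, h.diag_θ]; field_simp; ring

theorem ne_of_mem_fib {u w x : X} (hu : u ∉ fib φ w)
    (hx : x ∈ fib φ w) : u ≠ x := by
  rintro rfl; exact hu hx

theorem φ_eq_of_mem_fib (h : LinkedSystem X r θ φ) {u w x : X} (hu : u ∉ fib φ w)
    (hx : x ∈ fib φ w) : φ u x = -1 :=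
  h.φ_eq_of_notMem fun hx' => Finset.disjoint_left.1 (h.disjoint_fib hu) hx hx'

theorem θ_eq_of_mem_fib (h : LinkedSystem X r θ φ) {u w x : X} (hu : u ∉ fib φ w)
    (hx : x ∈ fib φ w) : θ u x = 2 + r * sgn r θ φ u x := by
  rw [h.θ_eq, h.φ_eq_of_mem_fib hu hx]; ring

theorem sum_fib_sgn (h : LinkedSystem X r θ φ) {w u : X} (hu : u ∉ fib φ w) :
    r * ∑ x ∈ fib φ w, sgn r θ φ u x = -2 * (Fintype.card X / 6) := by
  have h1 := h.sum_fib_θ w u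
  rw [Finset.sum_congr rfl fun x hx => h.θ_eq_of_mem_fib hu hx, Finset.sum_add_distrib,
    ← Finset.mul_sum] at h1
  have h2 := h.card_fib w
  have h3 : ∑ x ∈ fib φ w, (2 : ℝ) = 2 * ∑ x ∈ fib φ w, (1 : ℝ) := by
    rw [Finset.mul_sum]; simp
  rw [h3, h2] at h1
  linarith

theorem sum_fib_sgn_mul (h : LinkedSystem X r θ φ) {w u v : X} (hu : u ∉ fib φ w)
    (hv : v ∉ fib φ w) :
    r ^ 2 * ∑ x ∈ fib φ w, sgn r θ φ u x * sgn r θ φ v x =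
      Fintype.card X / 6 * (θ u v + 4) := by
  have h1 : r ^ 2 * ∑ x ∈ fib φ w, sgn r θ φ u x * sgn r θ φ v x =
      ∑ x ∈ fib φ w, (θ u x * θ v x - 2 * θ u x - 2 * θ v x + 4 * 1) := by
    rw [Finset.mul_sum]
    refine Finset.sum_congr rfl fun x hx => ?_
    rw [h.θ_eq_of_mem_fib hu hx, h.θ_eq_of_mem_fib hv hx]; ring
  rw [h1, Finset.sum_add_distrib, Finset.sum_sub_distrib, Finset.sum_sub_distrib,
    ← Finset.mul_sum, ← Finset.mul_sum, ← Finset.mul_sum, h.sum_fib_θθ, h.sum_fib_θ, h.sum_fib_θ,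
    h.card_fib]
  ring

theorem card_pos (h : LinkedSystem X r θ φ) : 0 < (Fintype.card X : ℝ) := by
  have := h.lt
  have h1 : 0 < r ^ 2 := by positivity
  have h2 : 0 < r ^ 2 - 1 := by nlinarith
  rw [h.card]; positivity

/-! ### Positive pairs, integrality of r, and positive triangles -/

theorem sgn_eq_one_iff (h : LinkedSystem X r θ φ) {u v : X} (huv : v ∉ fib φ u) :
    sgn r θ φ u v = 1 ↔ θ u v = 2 + r := by
  have := h.lt
  rw [h.θ_eq, h.φ_eq_of_notMem huv]
  constructor
  · intro h'; rw [h']; ring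
  · intro h'
    have : r * sgn r θ φ u v = r * 1 := by linarith
    exact mul_left_cancel₀ (by linarith) this

theorem exists_notMem_fib (h : LinkedSystem X r θ φ) (u v : X) :
    ∃ z, u ∉ fib φ z ∧ v ∉ fib φ z := by
  classical
  by_contra! H
  -- Otherwise two fibres would cover X, although together they have only n/3 points.
  have h1 : (Fintype.card X : ℝ) ≤ ∑ _x ∈ fib φ u, (1 : ℝ) + ∑ _x ∈ fib φ v, (1 : ℝ) := by
    have h2 : (Finset.univ : Finset X) ⊆ fib φ u ∪ fib φ v := by
      intro x _
      rw [Finset.mem_union]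
      by_cases hx : x ∈ fib φ u
      · exact Or.inl hx
      · exact Or.inr (h.mem_fib_comm.2 (H x fun h' => hx (h.mem_fib_comm.2 h')))
    have h3 := (Finset.card_le_card h2).trans (Finset.card_union_le _ _)
    rw [Finset.card_univ] at h3
    simp only [Finset.sum_const, nsmul_eq_mul, mul_one]
    exact_mod_cast h3
  rw [h.card_fib, h.card_fib] at h1
  have := h.card_pos
  linarith

theorem exists_edge (h : LinkedSystem X r θ φ) : ∃ u v, v ∉ fib φ u ∧ θ u v = 2 + r := by
  have hr := h.lt
  have hn := h.card_pos
  have hX : Nonempty X := Fintype.card_pos_iff.1 (by exact_mod_cast hn)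
  obtain ⟨u⟩ := hX
  obtain ⟨z, hz, -⟩ := h.exists_notMem_fib u u
  by_contra! H
  have h1 := h.sum_fib_sgn hz
  -- If all signs were -1, the sum of signs over the fibre would give r = 2.
  have h2 : ∑ x ∈ fib φ z, sgn r θ φ u x = ∑ x ∈ fib φ z, (-1 : ℝ) := by
    refine Finset.sum_congr rfl fun x hx => ?_
    have hxu : x ∉ fib φ u := Finset.disjoint_left.1 (h.disjoint_fib hz) hx
    refine (h.sgn_off_diag (ne_of_mem_fib hz hx)).resolve_left fun h' => ?_
    exact H u x hxu ((h.sgn_eq_one_iff hxu).1 h')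
  rw [h2, Finset.sum_neg_distrib, h.card_fib] at h1
  nlinarith

/-- Each summand is 1 if both signs are positive and 0 otherwise, so the sum counts the points of
the fibre in positive relation to both u and v; expanding the product reduces it to the one- and
two-sign sums. -/
theorem sum_fib_pos_mul (h : LinkedSystem X r θ φ) {u v z : X} (hu : u ∉ fib φ z)
    (hv : v ∉ fib φ z) (huv : θ u v = 2 + r) :
    ∑ x ∈ fib φ z, (1 + sgn r θ φ u x) / 2 * ((1 + sgn r θ φ v x) / 2) =
      (r ^ 2 - 1) * (r ^ 2 - 3 * r + 6) / 48 := by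
  have hr : r ≠ 0 := by have := h.lt; linarith
  have h1 := h.sum_fib_sgn hu
  have h2 := h.sum_fib_sgn hv
  have h3 := h.sum_fib_sgn_mul hu hv
  have h4 : ∑ x ∈ fib φ z, (1 + sgn r θ φ u x) / 2 * ((1 + sgn r θ φ v x) / 2) =
      (∑ _x ∈ fib φ z, (1 : ℝ) + ∑ x ∈ fib φ z, sgn r θ φ u x + ∑ x ∈ fib φ z, sgn r θ φ v x +
        ∑ x ∈ fib φ z, sgn r θ φ u x * sgn r θ φ v x) / 4 := by
    simp only [← Finset.sum_add_distrib, Finset.sum_div]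
    exact Finset.sum_congr rfl fun x _ => by ring
  rw [h4, h.card_fib]
  rw [huv] at h3
  have h1' := eq_div_of_mul_eq hr ((mul_comm _ _).trans h1)
  have h2' := eq_div_of_mul_eq hr ((mul_comm _ _).trans h2)
  have h3' := eq_div_of_mul_eq (pow_ne_zero 2 hr) ((mul_comm _ _).trans h3)
  rw [h1', h2', h3', h.card]
  field_simp
  ring

theorem sgn_mem_of_ne (h : LinkedSystem X r θ φ) {x y : X} (hxy : x ≠ y) :
    sgn r θ φ x y ∈ intSubring := by
  rcases h.sgn_off_diag hxy with h' | h' <;> rw [h']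
  · exact one_mem _
  · exact neg_mem (one_mem _)

/-- The parameter `r` is an integer. -/
theorem mem_intSubring (h : LinkedSystem X r θ φ) : r ∈ intSubring := by
  have hr := h.lt
  have hr0 : r ≠ 0 := by linarith
  obtain ⟨u, v, hvu, huv⟩ := h.exists_edge
  obtain ⟨z, hu, hv⟩ := h.exists_notMem_fib u v
  have hf : (Fintype.card X : ℝ) / 6 ∈ intSubring := by
    rw [← h.card_fib z]
    exact sum_mem fun _ _ => one_mem _
  have ha : ∑ x ∈ fib φ z, sgn r θ φ u x ∈ intSubring :=
    sum_mem fun x hx => h.sgn_mem_of_ne (ne_of_mem_fib hu hx)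
  have hb : ∑ x ∈ fib φ z, sgn r θ φ u x * sgn r θ φ v x ∈ intSubring :=
    sum_mem fun x hx => mul_mem (h.sgn_mem_of_ne (ne_of_mem_fib hu hx))
      (h.sgn_mem_of_ne (ne_of_mem_fib hv hx))
  have h1 := h.sum_fib_sgn hu
  have h3 := h.sum_fib_sgn_mul hu hv
  have hn := h.card_pos
  set a := ∑ x ∈ fib φ z, sgn r θ φ u x
  set b := ∑ x ∈ fib φ z, sgn r θ φ u x * sgn r θ φ v x
  -- The relation r a = -2(n/6) with a ≠ 0 makes r rational, so it is enough that r² is an integer.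
  refine mem_intSubring_of_sq ha (mul_mem (neg_mem (add_mem (one_mem _) (one_mem _))) hf) ?_
    (b := -(1 + 1) * ((Fintype.card X : ℝ) / 6)) (by linarith) ?_
  · intro ha0
    rw [ha0] at h1
    linarith
  · have ha' := eq_div_of_mul_eq hr0 ((mul_comm _ _).trans h1)
    have hb' := eq_div_of_mul_eq (pow_ne_zero 2 hr0) ((mul_comm _ _).trans h3)
    -- Here a = -r(r² - 1)/6 and b = (r² - 1)(r + 6)/12, so that 2b + a = r² - 1.
    have : r ^ 2 = 1 + (b + b) + a := by
      rw [ha', hb', huv, h.card]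
      field_simp
      ring
    rw [this]
    exact add_mem (add_mem (one_mem _) (add_mem hb hb)) ha

theorem exists_triangle (h : LinkedSystem X r θ φ) : ∃ u v w, v ∉ fib φ u ∧ u ∉ fib φ w ∧
    v ∉ fib φ w ∧ θ u v = 2 + r ∧ θ u w = 2 + r ∧ θ v w = 2 + r := by
  have hr := h.lt
  obtain ⟨u, v, hvu, huv⟩ := h.exists_edge
  obtain ⟨z, hu, hv⟩ := h.exists_notMem_fib u v
  have h1 := h.sum_fib_pos_mul hu hv huv
  -- The count of common positive neighbours is nonzero because r² - 3r + 6 has negative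
  -- discriminant.
  have h2 : 0 < (r ^ 2 - 1) * (r ^ 2 - 3 * r + 6) / 48 := by
    have : 0 < r ^ 2 - 1 := by nlinarith
    have : 0 < r ^ 2 - 3 * r + 6 := by nlinarith
    positivity
  rw [← h1] at h2
  obtain ⟨w, hw, hw0⟩ := Finset.exists_ne_zero_of_sum_ne_zero h2.ne'
  have hwu : w ∉ fib φ u := Finset.disjoint_left.1 (h.disjoint_fib hu) hw
  have hwv : w ∉ fib φ v := Finset.disjoint_left.1 (h.disjoint_fib hv) hw
  refine ⟨u, v, w, hvu, fun h' => hwu (h.mem_fib_comm.1 h'), fun h' => hwv (h.mem_fib_comm.1 h'),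
    huv, (h.sgn_eq_one_iff hwu).1 ?_, (h.sgn_eq_one_iff hwv).1 ?_⟩
  · refine (h.sgn_off_diag (ne_of_mem_fib hu hw)).resolve_right fun h' => hw0 ?_
    rw [h']; ring
  · refine (h.sgn_off_diag (ne_of_mem_fib hv hw)).resolve_right fun h' => hw0 ?_
    rw [h']; ring

/-! ### Triple sign sums and the determination of r -/

/-- The sum of the triple products of signs over a fibre containing one of the three points. -/
theorem sum_fib_sgn_triple (h : LinkedSystem X r θ φ) {u v w : X} (hu : u ∉ fib φ w)
    (hv : v ∉ fib φ w) (huv : θ u v = 2 + r) (huw : θ u w = 2 + r) (hvw : θ v w = 2 + r) :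
    r ^ 3 * ∑ x ∈ fib φ w, sgn r θ φ u x * sgn r θ φ v x * sgn r θ φ w x =
      (∑ x, θ u x * θ v x * θ w x) / 6 + 16 * (Fintype.card X / 6) := by
  have h1 : r ^ 3 * ∑ x ∈ fib φ w, sgn r θ φ u x * sgn r θ φ v x * sgn r θ φ w x =
      ∑ x ∈ fib φ w, (θ u x * θ v x * θ w x + 4 * (θ u x * θ v x) - 2 * (θ u x * θ w x)
        - 2 * (θ v x * θ w x) - 8 * θ u x - 8 * θ v x + 4 * θ w x + 16 * 1) := by
    rw [Finset.mul_sum]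
    refine Finset.sum_congr rfl fun x hx => ?_
    have h2 : θ w x = -4 + r * sgn r θ φ w x := by
      rw [h.θ_eq, mem_fib.1 hx]; ring
    rw [h.θ_eq_of_mem_fib hu hx, h.θ_eq_of_mem_fib hv hx, h2]; ring
  rw [h1]
  simp only [Finset.sum_add_distrib, Finset.sum_sub_distrib, ← Finset.mul_sum, h.sum_fib_θθ,
    h.sum_fib_θ, h.card_fib, h.sum_fib_θθθ, huv, huw, hvw]
  ring

theorem integer_identity (h : LinkedSystem X r θ φ) :
    ∃ M ∈ intSubring, 2 * r * M = 3 * (r ^ 2 - 1) * (r + 6) := by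
  classical
  have hr := h.lt
  have hr0 : r ≠ 0 := by linarith
  obtain ⟨u, v, w, hvu, huw', hvw', huv, huw, hvw⟩ := h.exists_triangle
  have hmem : ∀ x y, sgn r θ φ x y ∈ intSubring := by
    intro x y
    -- The diagonal value of the sign is r, so integrality of r is needed: each of u, v, w occurs in
    -- its own fibre.
    by_cases hxy : x = y
    · subst hxy; rw [h.sgn_diag]; exact h.mem_intSubring
    · exact h.sgn_mem_of_ne hxy
  set O : Finset X := Finset.univ \ (fib φ u ∪ fib φ v ∪ fib φ w) with hO
  have hsum : ∀ g : X → ℝ, ∑ x ∈ O, g x = ∑ x, g x -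
      (∑ x ∈ fib φ u, g x + ∑ x ∈ fib φ v, g x + ∑ x ∈ fib φ w, g x) := by
    intro g
    have d1 := h.disjoint_fib hvu
    have d2 : Disjoint (fib φ u ∪ fib φ v) (fib φ w) :=
      Finset.disjoint_union_left.2 ⟨(h.disjoint_fib huw').symm, (h.disjoint_fib hvw').symm⟩
    rw [hO, ← Finset.sum_sdiff (Finset.subset_univ (fib φ u ∪ fib φ v ∪ fib φ w)),
      Finset.sum_union d2, Finset.sum_union d1]
    ring
  have hOe : r ^ 3 * ∑ x ∈ O, sgn r θ φ u x * sgn r θ φ v x * sgn r θ φ w x =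
      ∑ x ∈ O, (θ u x * θ v x * θ w x - 2 * (θ u x * θ v x) - 2 * (θ u x * θ w x)
        - 2 * (θ v x * θ w x) + 4 * θ u x + 4 * θ v x + 4 * θ w x - 8 * 1) := by
    rw [Finset.mul_sum]
    refine Finset.sum_congr rfl fun x hx => ?_
    have hx' : (x ∉ fib φ u ∧ x ∉ fib φ v) ∧ x ∉ fib φ w := by
      simpa [hO, not_or, and_assoc] using hx
    rw [h.θ_eq u, h.θ_eq v, h.θ_eq w, h.φ_eq_of_notMem hx'.1.1, h.φ_eq_of_notMem hx'.1.2,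
      h.φ_eq_of_notMem hx'.2]
    ring
  have hT2 : ∑ x, θ v x * θ w x * θ u x = ∑ x, θ u x * θ v x * θ w x :=
    Finset.sum_congr rfl fun x _ => by ring
  have hT3 : ∑ x, θ u x * θ w x * θ v x = ∑ x, θ u x * θ v x * θ w x :=
    Finset.sum_congr rfl fun x _ => by ring
  have hS1 := h.sum_fib_θθθ w u v
  have hS2 : ∑ x ∈ fib φ u, θ u x * θ v x * θ w x = (∑ x, θ u x * θ v x * θ w x) / 6 := by
    rw [← hT2, ← h.sum_fib_θθθ]
    exact Finset.sum_congr rfl fun x _ => by ring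
  have hS3 : ∑ x ∈ fib φ v, θ u x * θ v x * θ w x = (∑ x, θ u x * θ v x * θ w x) / 6 := by
    rw [← hT3, ← h.sum_fib_θθθ]
    exact Finset.sum_congr rfl fun x _ => by ring
  have hO1 : ∑ _x ∈ O, (1 : ℝ) = Fintype.card X / 2 := by
    rw [hsum]; simp only [h.card_fib]; simp; ring
  have hOθ : ∀ u, ∑ x ∈ O, θ u x = 0 := by
    intro u
    rw [hsum]; simp [h.sum_fib_θ, h.sum_θ]
  have hOθθ : ∀ u v, ∑ x ∈ O, θ u x * θ v x = Fintype.card X / 2 * θ u v := by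
    intro u v
    rw [hsum]; simp only [h.sum_fib_θθ, h.sum_θθ]; ring
  have hOθθθ : ∑ x ∈ O, θ u x * θ v x * θ w x = (∑ x, θ u x * θ v x * θ w x) / 2 := by
    rw [hsum, hS1, hS2, hS3]; ring
  simp only [Finset.sum_add_distrib, Finset.sum_sub_distrib, ← Finset.mul_sum, hO1, hOθ, hOθθ,
    hOθθθ, huv, huw, hvw] at hOe
  have hFe := h.sum_fib_sgn_triple huw' hvw' huv huw hvw
  set eO := ∑ x ∈ O, sgn r θ φ u x * sgn r θ φ v x * sgn r θ φ w x with heO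
  set eF := ∑ x ∈ fib φ w, sgn r θ φ u x * sgn r θ φ v x * sgn r θ φ w x with heF
  have hmO : eO ∈ intSubring :=
    sum_mem fun x _ => mul_mem (mul_mem (hmem _ _) (hmem _ _)) (hmem _ _)
  have hmF : eF ∈ intSubring :=
    sum_mem fun x _ => mul_mem (mul_mem (hmem _ _) (hmem _ _)) (hmem _ _)
  -- The unknown total T enters r³ eF as T/6 and r³ eO as T/2, so 3 eF - eO eliminates it.
  refine ⟨eF + eF + eF - eO, sub_mem (add_mem (add_mem hmF hmF) hmF) hmO, ?_⟩
  rw [h.card] at hOe hFe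
  have h2 : r ^ 2 ≠ 0 := pow_ne_zero 2 hr0
  refine mul_left_cancel₀ h2 ?_
  linear_combination 6 * hFe - 2 * hOe

theorem eq_nine (h : LinkedSystem X r θ φ) : r = 9 := by
  have hr := h.lt
  obtain ⟨M, hM, h1⟩ := h.integer_identity
  obtain ⟨u, v, hvu, huv⟩ := h.exists_edge
  obtain ⟨z, hu, hv⟩ := h.exists_notMem_fib u v
  have h2 := h.sum_fib_pos_mul hu hv huv
  have hN : ∑ x ∈ fib φ z, (1 + sgn r θ φ u x) / 2 * ((1 + sgn r θ φ v x) / 2) ∈ intSubring := by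
    have : ∀ {a b : X}, a ≠ b → (1 + sgn r θ φ a b) / 2 ∈ intSubring := by
      intro a b hab
      rcases h.sgn_off_diag hab with h' | h' <;> rw [h']
      · norm_num [one_mem]
      · norm_num [zero_mem]
    exact sum_mem fun x hx => mul_mem (this (ne_of_mem_fib hu hx)) (this (ne_of_mem_fib hv hx))
  obtain ⟨N, hN⟩ := _root_.mem_intSubring.1 hN
  obtain ⟨M, rfl⟩ := _root_.mem_intSubring.1 hM
  obtain ⟨k, hk⟩ := _root_.mem_intSubring.1 h.mem_intSubring
  rw [← hN] at h2
  subst hk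
  have hk3 : 3 < k := by exact_mod_cast hr
  have e1 : 2 * k * M = 3 * (k ^ 2 - 1) * (k + 6) := by exact_mod_cast h1
  have e2 : 48 * N = (k ^ 2 - 1) * (k ^ 2 - 3 * k + 6) := by
    have : (48 : ℝ) * N = (k ^ 2 - 1) * (k ^ 2 - 3 * k + 6) := by rw [h2]; ring
    exact_mod_cast this
  -- The constant term of 3(k² - 1)(k + 6) is -18.
  have hdvd : k ∣ 18 := ⟨3 * k ^ 2 + 18 * k - 3 - 2 * M, by linear_combination e1⟩
  have hle : k ≤ 18 := Int.le_of_dvd (by norm_num) hdvd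
  -- The divisors of 18 above 3 are 6, 9 and 18; for 6 and 18 the right side of `e2`, 840 and 89148,
  -- is not divisible by 48.
  have : k = 9 := by
    interval_cases k <;> omega
  rw [this]; norm_num

end LinkedSystem

/-! ### Idempotents, eigenmatrix and Krein parameters of a general scheme -/

namespace QPolyScheme

section Scheme

theorem adj_apply_of_mem {X : Type*} {S : Set (X × X)} {x y : X} (h : (x, y) ∈ S) : adj S x y = 1 := by
  simp [adj, h]

theorem adj_apply_of_notMem {X : Type*} {S : Set (X × X)} {x y : X} (h : (x, y) ∉ S) : adj S x y = 0 := by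
  simp [adj, h]

variable {X : Type*} [Fintype X] [DecidableEq X] {D : ℕ} {R : Fin (D + 1) → Set (X × X)}

theorem IsAssociationScheme.card_pos (hR : IsAssociationScheme R) :
    0 < (Fintype.card X : ℝ) := by
  obtain ⟨⟨x, y⟩, -⟩ := hR.nonempty 0
  have : Nonempty X := ⟨x⟩
  exact_mod_cast Fintype.card_pos

theorem IsAssociationScheme.sum_adj_apply (hR : IsAssociationScheme R) (x y : X) :
    ∑ i, adj (R i) x y = 1 := by
  have := congrFun (congrFun hR.sum_adj x) y
  simpa [Matrix.sum_apply] using this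

/-- Every pair of points lies in exactly one relation. -/
theorem IsAssociationScheme.exists_adj (hR : IsAssociationScheme R) (x y : X) :
    ∃ j, (x, y) ∈ R j := by
  by_contra! H
  have := hR.sum_adj_apply x y
  simp [adj_apply_of_notMem (H _)] at this

theorem IsAssociationScheme.adj_apply (hR : IsAssociationScheme R) {x y : X} {j : Fin (D + 1)}
    (h : (x, y) ∈ R j) (i : Fin (D + 1)) : adj (R i) x y = if i = j then 1 else 0 := by
  split_ifs with hij
  · subst hij; exact adj_apply_of_mem h
  · refine adj_apply_of_notMem fun h' => ?_
    have h1 := hR.sum_adj_apply x y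
    have h2 : ∑ k ∈ ({i, j} : Finset (Fin (D + 1))), adj (R k) x y ≤ ∑ k, adj (R k) x y := by
      refine Finset.sum_le_sum_of_subset_of_nonneg (Finset.subset_univ _) fun k _ _ => ?_
      by_cases hk : (x, y) ∈ R k
      · rw [adj_apply_of_mem hk]; norm_num
      · rw [adj_apply_of_notMem hk]
    rw [Finset.sum_pair hij, adj_apply_of_mem h, adj_apply_of_mem h', h1] at h2
    norm_num at h2

theorem IsAssociationScheme.mem_zero_iff (hR : IsAssociationScheme R) {x y : X} :
    (x, y) ∈ R 0 ↔ x = y := by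
  have h := congrFun (congrFun hR.adj_zero x) y
  rw [Matrix.one_apply] at h
  constructor
  · intro h'
    rw [adj_apply_of_mem h'] at h
    by_contra hne
    simp [hne] at h
  · intro h'
    by_contra hne
    rw [adj_apply_of_notMem hne] at h
    simp [h'] at h

variable {E : Fin (D + 1) → Matrix X X ℝ} {Q : Matrix (Fin (D + 1)) (Fin (D + 1)) ℝ}
  {q : Fin (D + 1) → Fin (D + 1) → Fin (D + 1) → ℝ}

theorem IsSecondEigenmatrix.apply_eq (hR : IsAssociationScheme R)
    (hQ : IsSecondEigenmatrix R E Q) {x y : X} {j : Fin (D + 1)} (h : (x, y) ∈ R j)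
    (i : Fin (D + 1)) : E i x y = Q j i / Fintype.card X := by
  rw [hQ i]
  simp [Matrix.sum_apply, hR.adj_apply h]
  ring

theorem IsSecondEigenmatrix.symm (hR : IsAssociationScheme R)
    (hQ : IsSecondEigenmatrix R E Q) (i : Fin (D + 1)) (x y : X) : E i x y = E i y x := by
  obtain ⟨j, hj⟩ := hR.exists_adj x y
  have h1 : (y, x) ∈ R j := by
    by_contra h
    have := congrFun (congrFun (hR.symm j) x) y
    rw [Matrix.transpose_apply, adj_apply_of_mem hj, adj_apply_of_notMem h] at this
    norm_num at this
  rw [hQ.apply_eq hR hj, hQ.apply_eq hR h1]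

theorem IsSecondEigenmatrix.sum_mul (hR : IsAssociationScheme R)
    (hE : IsPrimitiveIdempotents R E) (hQ : IsSecondEigenmatrix R E Q) (i j : Fin (D + 1))
    (x y : X) : ∑ z, E i x z * E j y z = if i = j then E i x y else 0 := by
  have h1 : ∑ z, E i x z * E j y z = (E i * E j) x y := by
    rw [Matrix.mul_apply]
    exact Finset.sum_congr rfl fun z _ => by rw [hQ.symm hR j y z]
  rw [h1]
  split_ifs with hij
  · subst hij; rw [(hE.complete_orthogonal.idem i).eq]
  · rw [hE.complete_orthogonal.ortho hij]; rfl

theorem IsSecondEigenmatrix.sum_sum_mul (hR : IsAssociationScheme R)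
    (hE : IsPrimitiveIdempotents R E) (hQ : IsSecondEigenmatrix R E Q) (i j : Fin (D + 1)) :
    ∑ x, ∑ y, E i x y * E j x y = if i = j then Q 0 i else 0 := by
  simp only [hQ.sum_mul hR hE]
  split_ifs with hij
  · have hn := hR.card_pos
    rw [Finset.sum_congr rfl fun x _ => hQ.apply_eq hR (hR.mem_zero_iff.2 (rfl : x = x)) i]
    simp
    field_simp
  · simp

theorem IsSecondEigenmatrix.multiplicity_pos (hR : IsAssociationScheme R)
    (hE : IsPrimitiveIdempotents R E) (hQ : IsSecondEigenmatrix R E Q) (i : Fin (D + 1)) :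
    0 < Q 0 i := by
  have h1 := hQ.sum_sum_mul hR hE i i
  rw [if_pos rfl] at h1
  rw [← h1]
  have h0 : ∀ x y, 0 ≤ E i x y * E i x y := fun x y => mul_self_nonneg _
  obtain ⟨x, y, hxy⟩ : ∃ x y, E i x y ≠ 0 := by
    by_contra! H
    exact hE.ne_zero i (Matrix.ext H)
  refine Finset.sum_pos' (fun x _ => Finset.sum_nonneg fun y _ => h0 x y) ⟨x, Finset.mem_univ _, ?_⟩
  exact Finset.sum_pos' (fun y _ => h0 x y) ⟨y, Finset.mem_univ _, mul_self_pos.2 hxy⟩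

theorem IsKreinParameters.sum_sum_triple (hR : IsAssociationScheme R)
    (hE : IsPrimitiveIdempotents R E) (hQ : IsSecondEigenmatrix R E Q)
    (hq : IsKreinParameters E q) (i j k : Fin (D + 1)) :
    ∑ x, ∑ y, E i x y * E j x y * E k x y = 1 / (Fintype.card X) * (q i j k * Q 0 k) := by
  have h1 : ∀ x y, E i x y * E j x y * E k x y =
      1 / (Fintype.card X) * ∑ l, q i j l * (E l x y * E k x y) := by
    intro x y
    have := congrFun (congrFun (hq i j) x) y
    rw [Matrix.hadamard_apply] at this
    rw [this]
    simp [Matrix.sum_apply, Finset.sum_mul, mul_assoc]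
  simp only [h1, ← Finset.mul_sum]
  congr 1
  have h2 : ∀ x, ∑ y, ∑ l, q i j l * (E l x y * E k x y) =
      ∑ l, q i j l * ∑ y, E l x y * E k x y := by
    intro x
    rw [Finset.sum_comm]
    simp only [Finset.mul_sum]
  simp only [h2]
  rw [Finset.sum_comm]
  simp only [← Finset.mul_sum, hQ.sum_sum_mul hR hE]
  simp

/-- Up to the factor 1/n, both sides are the sum of the entries of E_i ∘ E_j ∘ E_k, which is
symmetric in j and k. -/
theorem IsKreinParameters.mul_multiplicity (hR : IsAssociationScheme R)
    (hE : IsPrimitiveIdempotents R E) (hQ : IsSecondEigenmatrix R E Q)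
    (hq : IsKreinParameters E q) (i j k : Fin (D + 1)) : q i j k * Q 0 k = q i k j * Q 0 j := by
  have hn := hR.card_pos
  have h1 := hq.sum_sum_triple hR hE hQ i j k
  have h2 := hq.sum_sum_triple hR hE hQ i k j
  have h3 : ∑ x, ∑ y, E i x y * E j x y * E k x y = ∑ x, ∑ y, E i x y * E k x y * E j x y :=
    Finset.sum_congr rfl fun x _ => Finset.sum_congr rfl fun y _ => by ring
  rw [h1, h2] at h3
  exact mul_left_cancel₀ (one_div_pos.2 hn).ne' h3

/-- The vanishing of a Krein parameter forces the vanishing of triple sums. -/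
theorem IsKreinParameters.sum_triple_eq_zero (hR : IsAssociationScheme R)
    (hE : IsPrimitiveIdempotents R E) (hQ : IsSecondEigenmatrix R E Q)
    (hq : IsKreinParameters E q) {i j k : Fin (D + 1)} (h0 : q i j k = 0) (u v w : X) :
    ∑ x, E i u x * E j v x * E k w x = 0 := by
  -- Because the E's are symmetric idempotents, the sum of the squares over all u, v, w equals the
  -- sum of the entries of E_i ∘ E_j ∘ E_k, which is q_{ij}^k m_k / n = 0, where m_k = Q_{0k}.
  have h1 : ∑ u, ∑ v, ∑ w, (∑ x, E i u x * E j v x * E k w x) ^ 2 = 0 := by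
    have h2 : ∀ u v w, (∑ x, E i u x * E j v x * E k w x) ^ 2 =
        ∑ x, ∑ y, (E i x u * E i y u) * (E j x v * E j y v) * (E k x w * E k y w) := by
      intro u v w
      rw [sq, Finset.sum_mul_sum]
      refine Finset.sum_congr rfl fun x _ => Finset.sum_congr rfl fun y _ => ?_
      rw [hQ.symm hR i u, hQ.symm hR j v, hQ.symm hR k w, hQ.symm hR i u, hQ.symm hR j v,
        hQ.symm hR k w]
      ring
    have h3 : ∀ x y, E i x y * E j x y * E k x y =
        ∑ u, ∑ v, ∑ w, (E i x u * E i y u) * (E j x v * E j y v) * (E k x w * E k y w) := by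
      intro x y
      have h4 : ∀ i, E i x y = ∑ u, E i x u * E i y u := by
        intro i
        rw [hQ.sum_mul hR hE, if_pos rfl]
      rw [h4 i, h4 j, h4 k, Finset.sum_mul_sum, Finset.sum_mul]
      refine Finset.sum_congr rfl fun u _ => ?_
      rw [Finset.sum_mul_sum]
    have h5 := hq.sum_sum_triple hR hE hQ i j k
    rw [h0, zero_mul, mul_zero] at h5
    rw [← h5]
    simp only [h2, h3]
    have c1 : ∀ (f : X → X → X → X → X → ℝ), ∑ u, ∑ v, ∑ w, ∑ x, ∑ y, f u v w x y =
        ∑ x, ∑ y, ∑ u, ∑ v, ∑ w, f u v w x y := by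
      intro f
      have h' := Finset.sum_comm (s := (Finset.univ : Finset (X × X × X)))
        (t := (Finset.univ : Finset (X × X)))
        (f := fun (a : X × X × X) (b : X × X) => f a.1 a.2.1 a.2.2 b.1 b.2)
      simpa only [Fintype.sum_prod_type] using h'
    exact c1 _
  have hnn : ∀ u v w, 0 ≤ (∑ x, E i u x * E j v x * E k w x) ^ 2 := fun _ _ _ => sq_nonneg _
  rw [Finset.sum_eq_zero_iff_of_nonneg fun u _ => Finset.sum_nonneg fun v _ =>
    Finset.sum_nonneg fun w _ => hnn u v w] at h1
  have h2 := h1 u (Finset.mem_univ _)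
  rw [Finset.sum_eq_zero_iff_of_nonneg fun v _ => Finset.sum_nonneg fun w _ => hnn u v w] at h2
  have h3 := h2 v (Finset.mem_univ _)
  rw [Finset.sum_eq_zero_iff_of_nonneg fun w _ => hnn u v w] at h3
  exact pow_eq_zero_iff (two_ne_zero) |>.1 (h3 w (Finset.mem_univ _))

/-- The hypothesis says that ∑ c_i E_i = 0, and nonzero orthogonal idempotents are linearly
independent. -/
theorem IsSecondEigenmatrix.mulVec_injective (hR : IsAssociationScheme R)
    (hE : IsPrimitiveIdempotents R E) (hQ : IsSecondEigenmatrix R E Q) {c : Fin (D + 1) → ℝ}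
    (hc : ∀ j, ∑ i, c i * Q j i = 0) (i : Fin (D + 1)) : c i = 0 := by
  have h1 : ∑ k, c k • E k = 0 := by
    ext x y
    obtain ⟨j, hj⟩ := hR.exists_adj x y
    have : ∑ k, c k * E k x y = 0 := by
      simp only [hQ.apply_eq hR hj, ← mul_div_assoc, ← Finset.sum_div, hc, zero_div]
    simpa [Matrix.sum_apply] using this
  have h2 : E i * ∑ k, c k • E k = c i • E i := by
    rw [Finset.mul_sum, Finset.sum_eq_single i]
    · rw [mul_smul_comm, (hE.complete_orthogonal.idem i).eq]
    · intro k _ hk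
      rw [mul_smul_comm, hE.complete_orthogonal.ortho hk.symm, smul_zero]
    · simp
  rw [h1, mul_zero] at h2
  exact (smul_eq_zero.1 h2.symm).resolve_right (hE.ne_zero i)

theorem IsSecondEigenmatrix.row_injective (hR : IsAssociationScheme R)
    (hE : IsPrimitiveIdempotents R E) (hQ : IsSecondEigenmatrix R E Q) {j j' : Fin (D + 1)}
    (h : Q j = Q j') : j = j' := by
  by_contra hne
  have h1 : Q.det = 0 := Matrix.det_zero_of_row_eq hne h
  obtain ⟨c, hc0, hc⟩ := Matrix.exists_mulVec_eq_zero_iff.2 h1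
  refine hc0 (funext fun i => hQ.mulVec_injective hR hE (c := c) (fun j => ?_) i)
  have := congrFun hc j
  rw [Matrix.mulVec, dotProduct] at this
  simpa [mul_comm] using this

/-- The columns of `Q` multiply with the Krein parameters as structure constants. -/
theorem IsKreinParameters.mul_eq (hR : IsAssociationScheme R)
    (hQ : IsSecondEigenmatrix R E Q) (hq : IsKreinParameters E q) (i k j : Fin (D + 1)) :
    Q j i * Q j k = ∑ l, q i k l * Q j l := by
  obtain ⟨⟨x, y⟩, hxy⟩ := hR.nonempty j
  have hn := hR.card_pos
  have h1 := congrFun (congrFun (hq i k) x) y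
  rw [Matrix.hadamard_apply] at h1
  simp only [Matrix.smul_apply, Matrix.sum_apply, hQ.apply_eq hR hxy, smul_eq_mul,
    ← mul_div_assoc, ← Finset.sum_div] at h1
  field_simp at h1
  linarith

theorem IsSecondEigenmatrix.col_zero (hR : IsAssociationScheme R)
    (hE : IsPrimitiveIdempotents R E) (hQ : IsSecondEigenmatrix R E Q) (j : Fin (D + 1)) :
    Q j 0 = 1 := by
  obtain ⟨⟨x, y⟩, hxy⟩ := hR.nonempty j
  have hn := hR.card_pos
  have h1 := hQ.apply_eq hR hxy 0
  rw [hE.zero] at h1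
  simp at h1
  field_simp at h1
  exact h1.symm

theorem IsSecondEigenmatrix.sum_row (hR : IsAssociationScheme R)
    (hE : IsPrimitiveIdempotents R E) (hQ : IsSecondEigenmatrix R E Q) (j : Fin (D + 1)) :
    ∑ i, Q j i = if j = 0 then (Fintype.card X : ℝ) else 0 := by
  obtain ⟨⟨x, y⟩, hxy⟩ := hR.nonempty j
  have hn := hR.card_pos
  have h1 := congrFun (congrFun hE.complete_orthogonal.complete x) y
  rw [Matrix.sum_apply, ← hR.adj_zero, hR.adj_apply hxy] at h1
  simp only [hQ.apply_eq hR hxy, ← Finset.sum_div] at h1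
  rw [div_eq_iff hn.ne'] at h1
  rw [h1]
  by_cases hj : j = 0
  · simp [hj]
  · simp [hj, Ne.symm hj]

theorem IsKreinParameters.zero_right (hR : IsAssociationScheme R)
    (hE : IsPrimitiveIdempotents R E) (hQ : IsSecondEigenmatrix R E Q)
    (hq : IsKreinParameters E q) (i k : Fin (D + 1)) : q i 0 k = if k = i then 1 else 0 := by
  have h1 := hQ.mulVec_injective hR hE (c := fun k => q i 0 k - if k = i then 1 else 0)
    (fun j => by
      have := hq.mul_eq hR hQ i 0 j
      rw [hQ.col_zero hR hE, mul_one] at this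
      simp [sub_mul, Finset.sum_sub_distrib, ← this]) k
  exact sub_eq_zero.1 h1

/-- The row sums ∑_l Q_{jl} vanish for j ≠ 0, so multiplying them by Q_{ji} is the same as
multiplying by Q_{0i}; then compare coefficients of the columns of Q. -/
theorem IsKreinParameters.sum_eq (hR : IsAssociationScheme R)
    (hE : IsPrimitiveIdempotents R E) (hQ : IsSecondEigenmatrix R E Q)
    (hq : IsKreinParameters E q) (i k : Fin (D + 1)) : ∑ l, q i l k = Q 0 i := by
  have h1 := hQ.mulVec_injective hR hE (c := fun k => ∑ l, q i l k - Q 0 i)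
    (fun j => by
      have h2 : ∑ k, (∑ l, q i l k) * Q j k = ∑ l, Q j i * Q j l := by
        simp only [hq.mul_eq hR hQ i _ j, Finset.sum_mul]
        exact Finset.sum_comm
      simp only [sub_mul, Finset.sum_sub_distrib, h2, ← Finset.mul_sum, hQ.sum_row hR hE]
      by_cases hj : j = 0
      · subst hj; simp
      · simp [hj]) k
  exact sub_eq_zero.1 h1

end Scheme

/-! ### The given Krein array -/

section KreinTable

variable {X : Type*} [Fintype X] [DecidableEq X] {R : Fin 5 → Set (X × X)}
  {E : Fin 5 → Matrix X X ℝ} {Q : Matrix (Fin 5) (Fin 5) ℝ} {q : Fin 5 → Fin 5 → Fin 5 → ℝ}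

open Polynomial in
-- The polynomial x v_i - ∑ q_{1i}^l v_l has degree below 5 and vanishes at the five distinct values
-- Q_{j1}, so it is zero. Its coefficient at x^k is -q_{1i}^k times the leading coefficient of v_k,
-- since x v_i has degree below k and the terms with l > k are absent. The vanishing parameters are
-- thus obtained from the top index downwards.
theorem IsKreinParameters.eq_zero_of_degree (hR : IsAssociationScheme R)
    (hE : IsPrimitiveIdempotents R E) (hQ : IsSecondEigenmatrix R E Q)
    (hq : IsKreinParameters E q)
    (hv : ∀ i : Fin 5, ∃ v : Polynomial ℝ, v.degree = ((i : ℕ) : WithBot ℕ) ∧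
      ∀ j, Q j i = v.eval (Q j 1)) {i k : Fin 5} (hik : (i : ℕ) + 1 < k)
    (hk : ∀ l : Fin 5, k < l → q 1 i l = 0) : q 1 i k = 0 := by
  choose v hdeg hev using hv
  have hinj : Function.Injective fun j => Q j 1 := by
    intro j j' h
    refine hQ.row_injective hR hE (funext fun i => ?_)
    rw [hev i j, hev i j', show Q j 1 = Q j' 1 from h]
  have hdegk : ∀ l, (v l).degree < (5 : ℕ) := by
    intro l
    rw [hdeg l]
    exact_mod_cast l.isLt
  have hdegi : (Polynomial.X * v i : ℝ[X]).degree = ((i + 1 : ℕ) : WithBot ℕ) := by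
    rw [degree_mul, degree_X, hdeg i]
    push_cast
    ring
  have hp : Polynomial.X * v i - ∑ l, C (q 1 i l) * v l = 0 := by
    refine eq_zero_of_degree_lt_of_eval_finset_eq_zero
      (Finset.univ.image fun j => Q j 1) ?_ ?_
    · rw [Finset.card_image_of_injective _ hinj, Finset.card_univ, Fintype.card_fin]
      refine (degree_sub_le _ _).trans_lt (max_lt ?_ ?_)
      · rw [hdegi]
        have := k.isLt
        exact_mod_cast (by omega : (i : ℕ) + 1 < 5)
      · refine (degree_sum_le _ _).trans_lt ?_
        rw [Finset.sup_lt_iff (WithBot.bot_lt_coe 5)]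
        intro l _
        rw [← smul_eq_C_mul]
        exact (degree_smul_le _ _).trans_lt (hdegk l)
    · intro x hx
      obtain ⟨j, -, rfl⟩ := Finset.mem_image.1 hx
      simp only [eval_sub, eval_mul, eval_X, eval_finsetSum, eval_C, ← hev]
      rw [hq.mul_eq hR hQ, sub_self]
  have hc := congrArg (fun p : Polynomial ℝ => p.coeff (k : ℕ)) hp
  simp only [coeff_sub, finsetSum_coeff, coeff_C_mul, coeff_zero] at hc
  rw [coeff_eq_zero_of_degree_lt (by rw [hdegi]; exact_mod_cast hik), zero_sub, neg_eq_zero,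
    Finset.sum_eq_single k] at hc
  · refine (mul_eq_zero.1 hc).resolve_right ?_
    rw [← natDegree_eq_of_degree_eq_some (hdeg k)]
    exact leadingCoeff_ne_zero.2 fun h => by
      have := hdeg k
      rw [h, degree_zero] at this
      exact absurd this (WithBot.bot_ne_coe)
  · intro l _ hl
    rcases lt_or_gt_of_ne hl with h | h
    · rw [coeff_eq_zero_of_degree_lt (by rw [hdeg l]; exact_mod_cast h), mul_zero]
    · rw [hk l h, zero_mul]
  · simp

/-- A `Q`-polynomial scheme with the given Krein array yields a linked system. -/
theorem linkedSystem (hR : IsAssociationScheme R) {r : ℝ} (hr : 0 < r)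
    (hE : IsPrimitiveIdempotents R E) (hQ : IsSecondEigenmatrix R E Q)
    (hv : ∀ i : Fin 5, ∃ v : Polynomial ℝ, v.degree = ((i : ℕ) : WithBot ℕ) ∧
      ∀ j, Q j i = v.eval (Q j 1))
    (hq : IsKreinParameters E q)
    (hb : ∀ i : Fin 4, q 1 i.succ i.castSucc = ![r ^ 2 - 4, r ^ 2 - 9, 10, 1] i)
    (hc : ∀ i : Fin 4, q 1 i.castSucc i.succ = ![1, 2, r ^ 2 - 9, r ^ 2 - 4] i) :
    LinkedSystem X r (fun x y => Fintype.card X * E 1 x y)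
      (fun x y => Fintype.card X * E 4 x y) := by
  have hn := hR.card_pos
  have q110 : q 1 1 0 = r ^ 2 - 4 := hb 0
  have q121 : q 1 2 1 = r ^ 2 - 9 := hb 1
  have q132 : q 1 3 2 = 10 := hb 2
  have q143 : q 1 4 3 = 1 := hb 3
  have q112 : q 1 1 2 = 2 := hc 1
  have q123 : q 1 2 3 = r ^ 2 - 9 := hc 2
  have q134 : q 1 3 4 = r ^ 2 - 4 := hc 3
  have hz := hq.zero_right hR hE hQ 1
  have hpos := hQ.multiplicity_pos hR hE
  have q114 : q 1 1 4 = 0 := hq.eq_zero_of_degree hR hE hQ hv (by decide)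
    (fun l hl => absurd hl (by revert l; decide))
  have q113 : q 1 1 3 = 0 := hq.eq_zero_of_degree hR hE hQ hv (by decide)
    (fun l hl => by
      have : l = 4 := by revert l; decide
      rw [this, q114])
  have q124 : q 1 2 4 = 0 := hq.eq_zero_of_degree hR hE hQ hv (by decide)
    (fun l hl => absurd hl (by revert l; decide))
  have hsymm : ∀ i k, q 1 i k = 0 → q 1 k i = 0 := by
    intro i k h
    have := hq.mul_multiplicity hR hE hQ 1 i k
    rw [h, zero_mul] at this
    exact (mul_eq_zero.1 this.symm).resolve_right (hpos i).ne'
  have q131 := hsymm _ _ q113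
  have q141 := hsymm _ _ q114
  have q142 := hsymm _ _ q124
  have q120 : q 1 2 0 = 0 := hsymm 0 2 (by rw [hz]; rfl)
  have q130 : q 1 3 0 = 0 := hsymm 0 3 (by rw [hz]; rfl)
  have q140 : q 1 4 0 = 0 := hsymm 0 4 (by rw [hz]; rfl)
  have q101 : q 1 0 1 = 1 := by rw [hz]; rfl
  have q102 : q 1 0 2 = 0 := by rw [hz]; rfl
  have q103 : q 1 0 3 = 0 := by rw [hz]; rfl
  have q104 : q 1 0 4 = 0 := by rw [hz]; rfl
  have hcol0 := hQ.col_zero hR hE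
  have hs : Q 0 1 = r ^ 2 - 4 := by
    have := hq.mul_multiplicity hR hE hQ 1 0 1
    rw [q101, q110, hcol0] at this
    linarith
  have hsum := hq.sum_eq hR hE hQ 1
  simp only [hs] at hsum
  -- The diagonal parameters follow from ∑_l q_{1l}^k = Q_{01} = r² - 4.
  have q111 : q 1 1 1 = 4 := by
    have := hsum 1
    rw [Fin.sum_univ_five, q101, q121, q131, q141] at this
    linarith
  have q122 : q 1 2 2 = r ^ 2 - 16 := by
    have := hsum 2
    rw [Fin.sum_univ_five, q102, q112, q132, q142] at this
    linarith
  have q133 : q 1 3 3 = 4 := by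
    have := hsum 3
    rw [Fin.sum_univ_five, q103, q113, q123, q143] at this
    linarith
  have q144 : q 1 4 4 = 0 := by
    have := hsum 4
    rw [Fin.sum_univ_five, q104, q114, q124, q134] at this
    linarith
  have e1 : ∀ j, Q j 1 * Q j 1 = r ^ 2 - 4 + 4 * Q j 1 + 2 * Q j 2 := by
    intro j
    rw [hq.mul_eq hR hQ, Fin.sum_univ_five, q110, q111, q112, q113, q114, hcol0]
    ring
  have e2 : ∀ j, Q j 1 * Q j 2 = (r ^ 2 - 9) * Q j 1 + (r ^ 2 - 16) * Q j 2 +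
      (r ^ 2 - 9) * Q j 3 := by
    intro j
    rw [hq.mul_eq hR hQ, Fin.sum_univ_five, q120, q121, q122, q123, q124]
    ring
  have e3 : ∀ j, Q j 1 * Q j 3 = 10 * Q j 2 + 4 * Q j 3 + (r ^ 2 - 4) * Q j 4 := by
    intro j
    rw [hq.mul_eq hR hQ, Fin.sum_univ_five, q130, q131, q132, q133, q134]
    ring
  have e4 : ∀ j, Q j 1 * Q j 4 = Q j 3 := by
    intro j
    rw [hq.mul_eq hR hQ, Fin.sum_univ_five, q140, q141, q142, q143, q144]
    ring
  -- With m₁ = r² - 4, `e1` at 0 reads m₁(m₁ - 5) = 2 m₂, and both multiplicities are positive.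
  have hlt : 9 < r ^ 2 := by
    have h1 := hpos 1
    have h2 := hpos 2
    have h3 := e1 0
    rw [hs] at h1 h3
    nlinarith
  -- Substitute Q_{j3} = Q_{j1} Q_{j4} in `e3` and subtract Q_{j4} times `e1`. This dichotomy
  -- separates pairs in a common fibre (Q_{j4} = 5) from the others (Q_{j2} = 0).
  have h5 : ∀ j, Q j 2 * (Q j 4 - 5) = 0 := by
    intro j
    have h3 := e3 j
    rw [← e4 j] at h3
    linear_combination (1 / 2) * h3 - (1 / 2) * Q j 4 * e1 j
  have hφ0 : Q 0 4 = 5 := by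
    have := (mul_eq_zero.1 (h5 0)).resolve_left (hpos 2).ne'
    linarith
  have hinj : ∀ j, Q j 1 = Q 0 1 → j = 0 := by
    intro j hj
    refine hQ.row_injective hR hE (funext fun i => ?_)
    obtain ⟨v, -, hv⟩ := hv i
    rw [hv j, hv 0, hj]
  have hcases : ∀ j, j ≠ 0 → (Q j 4 = 5 ∧ (Q j 1 = -4 + r ∨ Q j 1 = -4 - r)) ∨
      (Q j 4 = -1 ∧ (Q j 1 = 2 + r ∨ Q j 1 = 2 - r)) := by
    intro j hj
    have h1 := e1 j
    have h2 := e2 j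
    rw [← e4 j] at h2
    rcases mul_eq_zero.1 (h5 j) with h0 | h0
    · right
      rw [h0] at h1 h2
      have hθ : Q j 1 ≠ 0 := by
        intro h'
        rw [h'] at h1
        linarith
      have h3 : (Q j 1 * (r ^ 2 - 9)) * (Q j 4 + 1) = 0 := by linear_combination -h2
      have h4 := (mul_eq_zero.1 h3).resolve_left (mul_ne_zero hθ (by linarith))
      refine ⟨by linarith, ?_⟩
      have h6 : (Q j 1 - (2 + r)) * (Q j 1 - (2 - r)) = 0 := by linear_combination h1
      rcases mul_eq_zero.1 h6 with h | h
      · left; linarith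
      · right; linarith
    · left
      have h4 : Q j 4 = 5 := by linarith
      refine ⟨h4, ?_⟩
      rw [h4] at h2
      -- Eliminating Q_{j2} from `e1` and `e2` leaves a cubic in Q_{j1}; its root r² - 4 is the
      -- valency value, attained only at j = 0.
      have h6 : (Q j 1 - (r ^ 2 - 4)) * ((Q j 1 - (-4 + r)) * (Q j 1 - (-4 - r))) = 0 := by
        linear_combination 2 * h2 + (Q j 1 - (r ^ 2 - 16)) * h1
      have h7 : Q j 1 - (r ^ 2 - 4) ≠ 0 := by
        intro h
        exact hj (hinj j (by rw [hs]; linarith))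
      rcases mul_eq_zero.1 ((mul_eq_zero.1 h6).resolve_left h7) with h | h
      · left; linarith
      · right; linarith
  have hent : ∀ {x y j}, (x, y) ∈ R j → ∀ i, Fintype.card X * E i x y = Q j i := by
    intro x y j h i
    rw [hQ.apply_eq hR h, mul_div_cancel₀ _ hn.ne']
  have hE0 : ∀ x y, E 0 x y = 1 / Fintype.card X := by
    intro x y
    rw [hE.zero]; simp
  have hsum0 : ∀ i : Fin 5, i ≠ 0 → ∀ u, ∑ x, (Fintype.card X : ℝ) * E i u x = 0 := by
    intro i hi u
    have := hQ.sum_mul hR hE i 0 u u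
    rw [if_neg hi] at this
    simp only [hE0, ← Finset.sum_mul] at this
    rw [← Finset.mul_sum, (mul_eq_zero.1 this).resolve_right (one_div_pos.2 hn).ne', mul_zero]
  have hsum2 : ∀ i j : Fin 5, ∀ u v, ∑ x, (Fintype.card X * E i u x) * (Fintype.card X * E j v x) =
      Fintype.card X * (Fintype.card X * if i = j then E i u v else 0) := by
    intro i j u v
    rw [← hQ.sum_mul hR hE i j u v, Finset.mul_sum, Finset.mul_sum]
    exact Finset.sum_congr rfl fun x _ => by ring
  have hsum3 : ∀ k : Fin 5, q 1 1 k = 0 → ∀ u v w, ∑ x, (Fintype.card X * E 1 u x) *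
      (Fintype.card X * E 1 v x) * (Fintype.card X * E k w x) = 0 := by
    intro k hk u v w
    have := hq.sum_triple_eq_zero hR hE hQ hk u v w
    rw [← mul_zero ((Fintype.card X : ℝ) ^ 3), ← this, Finset.mul_sum]
    exact Finset.sum_congr rfl fun x _ => by ring
  refine
    { lt := by nlinarith
      card := ?_
      symm_θ := fun x y => by rw [hQ.symm hR]
      symm_φ := fun x y => by rw [hQ.symm hR]
      diag_θ := fun x => by rw [hent (hR.mem_zero_iff.2 rfl), hs]
      diag_φ := fun x => by rw [hent (hR.mem_zero_iff.2 rfl), hφ0]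
      off_diag := ?_
      sum_θ := hsum0 1 (by decide)
      sum_φ := hsum0 4 (by decide)
      sum_φφ := fun u v => by rw [hsum2, if_pos rfl]
      sum_θθ := fun u v => by rw [hsum2, if_pos rfl]
      sum_θφ := fun u w => by rw [hsum2, if_neg (by decide)]; simp
      sum_θθφ := hsum3 4 q114
      sum_θθθφ := ?_ }
  -- n is the sum of the multiplicities 1, m₁ = r² - 4, m₂ = m₁(m₁ - 5)/2, m₃ = 5 m₁ and m₄ = 5.
  · have h1 := hQ.sum_row hR hE 0
    rw [if_pos rfl, Fin.sum_univ_five, hcol0, ← e4 0, hφ0, hs] at h1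
    have h2 := e1 0
    rw [hs] at h2
    linear_combination -h1 - (1 / 2) * h2
  · intro x y hxy
    obtain ⟨j, hj⟩ := hR.exists_adj x y
    rw [hent hj, hent hj]
    refine hcases j ?_
    rintro rfl
    exact hxy (hR.mem_zero_iff.1 hj)
  · intro u v w
    -- By `e4`, θ_w φ_w is n E₃, so the four-factor sum is the triple sum governed by q₁₁³ = 0.
    rw [← hsum3 3 q113 u v w]
    refine Finset.sum_congr rfl fun x _ => ?_
    obtain ⟨j, hj⟩ := hR.exists_adj w x
    rw [hent hj 1, hent hj 4, hent hj 3, e4]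

end KreinTable

end QPolyScheme

theorem mainTheorem3 {X : Type*} [Fintype X] [DecidableEq X]
    (R : Fin 5 → Set (X × X)) (hR : QPolyScheme.IsAssociationScheme R)
    (r : ℝ) (hr : 0 < r)
    (hK : QPolyScheme.IsQPolynomialWithKreinArray R
      ![r ^ 2 - 4, r ^ 2 - 9, 10, 1] ![1, 2, r ^ 2 - 9, r ^ 2 - 4]) :
    r = 9 := by
  obtain ⟨E, ⟨hE, Q, hQ, hv⟩, q, hq, hb, hc⟩ := hK
  exact (QPolyScheme.linkedSystem hR hr hE hQ hv hq hb hc).eq_nine
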